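/- Let $1\le N\le M$ and let $\mathcal S=\{s_1<\dots<s_N\}\subset\{1,\dots,M\}$ be such that every lag $0,1,\dots,M-1$ is a difference $s_i-s_j$ (a sparse array with the aperture of the $M$-element uniform linear array and with no holes in its co-array). For $\theta\in[0,\pi]$ let $\mathbf a(\theta)\in\mathbb C^M$ have entries $[\mathbf a(\theta)]_i=e^{\,j\pi\left(i-1-\frac{M-1}{2}\right)\cos\theta}$, $i=1,\dots,M$. Let $1\le k\le M-1$, let $p_1,\dots,p_k>0$ be fixed, and for $\boldsymbol\theta\in[0,\pi]^k$ put $$\mathbf A(\boldsymbol\theta)=[\mathbf a(\theta_1)\ \cdots\ \mathbf a(\theta_k)],\qquad \mathbf R_{\mathcal S}(\boldsymbol\theta)=\boldsymbol\Gamma\,\mathbf A(\boldsymbol\theta)\,\mathrm{diag}(p_1,\dots,p_k)\,\mathbf A(\boldsymbol\theta)^{\mathsf H}\,\boldsymbol\Gamma^{\mathsf T}\in\mathbb C^{N\times N},$$ where $\boldsymbol\Gamma\in\{0,1\}^{N\times M}$ selects the rows $s_1,\dots,s_N$. Represent $\mathrm{Gr}(k,M)$ by orthogonal projectors, $\mathrm{Gr}(k,M)=\{P\in\mathbb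 C^{M\times M}: P^{\mathsf H}=P,\ P^2=P,\ \operatorname{rank}P=k\}$, let $P_{\mathbf A}$ be the orthogonal projector onto the range of $\mathbf A$, and let $d_k^{\mathrm{Geo}}=\big(\sum_{i=1}^k\phi_i^2\big)^{1/2}$, where $\phi_i=\arccos\sigma_i(\mathbf U^{\mathsf H}\tilde{\mathbf U})$, $i=1,\dots,k$, are the principal angles of the two subspaces, the columns of $\mathbf U$ and $\tilde{\mathbf U}$ being unitary bases of them and $\sigma_1\ge\sigma_2\ge\cdots$ denoting singular values. (For almost every $\boldsymbol\theta$ the matrix $\mathbf A(\boldsymbol\theta)$ has rank $k$, so that $P_{\mathbf A(\boldsymbol\theta)}\in\mathrm{Gr}(k,M)$.) A ReLU network is a composition of finitely many layers $x\mapsto\max(0,Wx+b)$ (componentwise) followed by a final affine map $x\mapsto Wx+b$; it acts on a complex matrix through the real and imaginary parts of the entries, and its real outputs are recombined into a complex matrix. A ReLU network $F:\mathbb C^{N\times N}\to\mathbb C^{M\times M}$ generates a map $f:\mathbb C^{N\times N}\to\mathrm{Gr}(k,M)$ if, for every $R$, $f(R)$ is the orthogonal projector onto the span of eigenvectors belonging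 to the $k$ largest eigenvalues in some eigenvalue decomposition (in an orthonormal basis) of the Gram matrix $F(R)F(R)^{\mathsf H}$. Then for every $\epsilon>0$ there are a ReLU network $F$ and a map $f:\mathbb C^{N\times N}\to\mathrm{Gr}(k,M)$ generated by $F$ such that for almost every $\boldsymbol\theta\in[0,\pi]^k$ the point $f(\mathbf R_{\mathcal S}(\boldsymbol\theta))$ is uniquely determined by $F(\mathbf R_{\mathcal S}(\boldsymbol\theta))$ (that is, independent of the choice of the eigenvalue decomposition), the integrand below is integrable, and $$\int_{[0,\pi]^k} d_k^{\mathrm{Geo}}\big(f(\mathbf R_{\mathcal S}(\boldsymbol\theta)),\,P_{\mathbf A(\boldsymbol\theta)}\big)\,d\boldsymbol\theta<\epsilon .$$ -/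

import Mathlib

open MeasureTheory
open scoped Matrix

namespace SubspaceLearning

noncomputable section

/-! ### Array model -/

/-- The array manifold `a(θ)` of the `M`-element ULA with half-wavelength spacing, centred at the
origin (sensors are indexed from `0`). -/
def arrayManifold (M : ℕ) (θ : ℝ) : Fin M → ℂ := fun i =>
  Complex.exp (Complex.I * ((2 * Real.pi * ((i : ℝ) - ((M : ℝ) - 1) / 2) * (1 / 2) * Real.cos θ : ℝ) : ℂ))

/-- `A(θ) = [a(θ₁) ⋯ a(θₖ)]`. -/
def steeringMatrix (M : ℕ) {k : ℕ} (θ : Fin k → ℝ) : Matrix (Fin M) (Fin k) ℂ :=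
  Matrix.of fun i l => arrayManifold M (θ l) i

/-- The row selection matrix `Γ` of the array with sensors `s₁ < ⋯ < s_N`. -/
def selectionMatrix {M N : ℕ} (s : Fin N → Fin M) : Matrix (Fin N) (Fin M) ℂ :=
  Matrix.of fun n m => if s n = m then 1 else 0

/-- The co-array has no holes and the aperture of the `M`-element ULA: every lag `0, …, M - 1`
is a difference of two sensor positions. -/
def HoleFree {M N : ℕ} (s : Fin N → Fin M) : Prop :=
  ∀ l : ℕ, l < M → ∃ i j : Fin N, (s i : ℕ) = (s j : ℕ) + l

/-- The noiseless covariance `R₀ = A(θ) P A(θ)ᴴ` of the ULA, `P = diag(p₁, …, pₖ)`. -/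
def ulaCovariance (M : ℕ) {k : ℕ} (p : Fin k → ℝ) (θ : Fin k → ℝ) : Matrix (Fin M) (Fin M) ℂ :=
  steeringMatrix M θ * Matrix.diagonal (fun l => (p l : ℂ)) * (steeringMatrix M θ)ᴴ

/-- The noiseless covariance `R_S = Γ R₀ Γᵀ` of the sparse array. -/
def slaCovariance {M N k : ℕ} (s : Fin N → Fin M) (p : Fin k → ℝ) (θ : Fin k → ℝ) :
    Matrix (Fin N) (Fin N) ℂ :=
  selectionMatrix s * ulaCovariance M p θ * (selectionMatrix s)ᵀ

/-! ### The Grassmannian and the geodesic distance -/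

/-- `Gr(k, M)`, each subspace being represented by its orthogonal projector. -/
def Grassmannian (k M : ℕ) : Set (Matrix (Fin M) (Fin M) ℂ) :=
  {P | Pᴴ = P ∧ P * P = P ∧ P.rank = k}

/-- The column space of a matrix. -/
def colSpace {M n : ℕ} (A : Matrix (Fin M) (Fin n) ℂ) : Submodule ℂ (EuclideanSpace ℂ (Fin M)) :=
  LinearMap.range (Matrix.toEuclideanLin A)

/-- `P_A`, the matrix of the orthogonal projection of `ℂ^M` onto the column space of `A`. -/
def rangeProjector {M n : ℕ} (A : Matrix (Fin M) (Fin n) ℂ) : Matrix (Fin M) (Fin M) ℂ :=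
  Matrix.toEuclideanLin.symm
    ((colSpace A).starProjection : EuclideanSpace ℂ (Fin M) →ₗ[ℂ] EuclideanSpace ℂ (Fin M))

/-- A matrix whose columns form an orthonormal (unitary) basis of `U`. -/
def unitaryBasis {M : ℕ} (U : Submodule ℂ (EuclideanSpace ℂ (Fin M))) :
    Matrix (Fin M) (Fin (Module.finrank ℂ U)) ℂ :=
  Matrix.of fun i j => (stdOrthonormalBasis ℂ U j : EuclideanSpace ℂ (Fin M)) i

/-- The principal angles `arccos (σᵢ (Uᴴ V))` between two subspaces (indexed from `0`), where the
columns of `U` and `V` are unitary bases and `σ₀ ≥ σ₁ ≥ ⋯` are the singular values. -/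
def principalAngle {M : ℕ} (U V : Submodule ℂ (EuclideanSpace ℂ (Fin M))) (i : ℕ) : ℝ :=
  Real.arccos ((Matrix.toEuclideanLin ((unitaryBasis U)ᴴ * unitaryBasis V)).singularValues i)

/-- The geodesic distance `d_k^Geo` between the points of `Gr(k, M)` with projectors `P`, `Q`:
the Euclidean norm of the vector of the `k` principal angles between their ranges. -/
def geodesicDist {M : ℕ} (k : ℕ) (P Q : Matrix (Fin M) (Fin M) ℂ) : ℝ :=
  Real.sqrt (∑ i ∈ Finset.range k, principalAngle (colSpace P) (colSpace Q) i ^ 2)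

/-! ### ReLU networks -/

/-- Feedforward ReLU networks with inputs indexed by the second and outputs by the first type:
finitely many hidden layers (an affine map followed by a coordinatewise ReLU) and an affine
output layer. -/
inductive ReLUNetwork (κ : Type) : Type → Type 1
  | output {ι : Type} (L : (ι → ℝ) →ᵃ[ℝ] (κ → ℝ)) : ReLUNetwork κ ι
  | hidden {ι : Type} (h : ℕ) (L : (ι → ℝ) →ᵃ[ℝ] (Fin h → ℝ))
      (rest : ReLUNetwork κ (Fin h)) : ReLUNetwork κ ι

/-- The function computed by a ReLU network. -/
def ReLUNetwork.eval {κ : Type} : {ι : Type} → ReLUNetwork κ ι → (ι → ℝ) → (κ → ℝ)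
  | _, .output L, x => L x
  | _, .hidden _ L rest, x => rest.eval (fun i => max 0 (L x i))

/-- The indices of the real and of the imaginary parts of the entries of an `n × n` matrix. -/
abbrev ReImIndex (n : ℕ) : Type := (Fin n × Fin n) ⊕ (Fin n × Fin n)

/-- The real and imaginary parts of the entries of a complex matrix. -/
def splitReIm {n : ℕ} (R : Matrix (Fin n) (Fin n) ℂ) : ReImIndex n → ℝ :=
  Sum.elim (fun q => (R q.1 q.2).re) (fun q => (R q.1 q.2).im)

/-- The complex matrix with the given real and imaginary parts. -/
def combineReIm {n : ℕ} (x : ReImIndex n → ℝ) : Matrix (Fin n) (Fin n) ℂ :=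
  Matrix.of fun i j => ⟨x (Sum.inl (i, j)), x (Sum.inr (i, j))⟩

/-- The map `ℂ^{N×N} → ℂ^{M×M}` computed by a real ReLU network acting on real and imaginary
parts. -/
def ReLUNetwork.evalMatrix {N M : ℕ} (F : ReLUNetwork (ReImIndex M) (ReImIndex N))
    (R : Matrix (Fin N) (Fin N) ℂ) : Matrix (Fin M) (Fin M) ℂ :=
  combineReIm (F.eval (splitReIm R))

/-- `P` is the orthogonal projector onto the span of the first `k` eigenvectors in some
eigenvalue decomposition `X Xᴴ = W diag(d) Wᴴ`, `W` unitary, `d₀ ≥ d₁ ≥ ⋯`, of the Gram matrix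
of `X`. This is how an `M × M` output matrix `X` of a network represents a point of `Gr(k, M)`. -/
def IsLeadingProjector {M : ℕ} (k : ℕ) (X P : Matrix (Fin M) (Fin M) ℂ) : Prop :=
  ∃ W ∈ Matrix.unitaryGroup (Fin M) ℂ, ∃ d : Fin M → ℝ, Antitone d ∧
    X * Xᴴ = W * Matrix.diagonal (fun i => (d i : ℂ)) * Wᴴ ∧
    P = W * Matrix.diagonal (fun i : Fin M => if (i : ℕ) < k then (1 : ℂ) else 0) * Wᴴ

end

end SubspaceLearning

namespace SubspaceLearning

open scoped ComplexOrder

/-! Nothing has to be approximated: a network independent of `ε` makes the integrand vanish almost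
everywhere. The ULA covariance is Toeplitz, so each entry depends only on its lag, and a hole-free
co-array realises every lag at some fixed position of the sparse covariance. Recovering the ULA
covariance is thus a mere rearrangement of entries, which a ReLU network computes exactly
(`exists_evalMatrix_slaCovariance_eq`).

For almost every `θ` the directions are distinct and interior, and a Vandermonde argument makes the
columns of `A` independent (`steeringMatrix_mulVec_injective`). The Gram matrix of `A D Aᴴ` then has
rank exactly `k` and the range of `A`, so every eigenvalue decomposition yields the leading
projector `P_A` (`IsLeadingProjector.eq_rangeProjector`). This gives both uniqueness and zero
distance. -/

/-! ### Leading projectors -/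

/-- The spectral theorem with the eigenvalues in decreasing order. -/
theorem exists_antitone_eigendecomposition {M : ℕ} {H : Matrix (Fin M) (Fin M) ℂ}
    (hH : H.IsHermitian) :
    ∃ W ∈ Matrix.unitaryGroup (Fin M) ℂ, ∃ d : Fin M → ℝ, Antitone d ∧
      H = W * Matrix.diagonal (fun i => (d i : ℂ)) * Wᴴ := by
  set σ := Tuple.sort (fun i => -hH.eigenvalues i) with hσ
  set V : Matrix (Fin M) (Fin M) ℂ := hH.eigenvectorUnitary.1 with hV
  have hVu : V * Vᴴ = 1 := Matrix.mem_unitaryGroup_iff.1 hH.eigenvectorUnitary.2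
  have key : H = V * Matrix.diagonal (fun i => (hH.eigenvalues i : ℂ)) * Vᴴ := by
    have := hH.spectral_theorem
    rw [Unitary.conjStarAlgAut_apply] at this
    exact this
  refine ⟨V.submatrix id σ, ?_, fun i => hH.eigenvalues (σ i), ?_, ?_⟩
  · rw [Matrix.mem_unitaryGroup_iff, Matrix.star_eq_conjTranspose, Matrix.conjTranspose_submatrix,
      Matrix.submatrix_mul_equiv, hVu, Matrix.submatrix_id_id]
  · intro i j hij
    exact neg_le_neg_iff.1 (Tuple.monotone_sort (fun i => -hH.eigenvalues i) hij)
  · have hd : Matrix.diagonal (fun i => (hH.eigenvalues (σ i) : ℂ)) =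
        (Matrix.diagonal (fun i => (hH.eigenvalues i : ℂ))).submatrix σ σ := by
      rw [Matrix.submatrix_diagonal_equiv]
      rfl
    rw [hd, Matrix.conjTranspose_submatrix, Matrix.submatrix_mul_equiv, Matrix.submatrix_mul_equiv,
      Matrix.submatrix_id_id]
    exact key

theorem exists_isLeadingProjector {M : ℕ} (k : ℕ) (X : Matrix (Fin M) (Fin M) ℂ) :
    ∃ P, IsLeadingProjector k X P := by
  obtain ⟨W, hW, d, hd, h⟩ :=
    exists_antitone_eigendecomposition (Matrix.isHermitian_mul_conjTranspose_self X)
  exact ⟨_, W, hW, d, hd, h, rfl⟩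

theorem IsLeadingProjector.mem_grassmannian {M k : ℕ} (hk : k ≤ M)
    {X P : Matrix (Fin M) (Fin M) ℂ} (h : IsLeadingProjector k X P) : P ∈ Grassmannian k M := by
  obtain ⟨W, hW, d, -, -, rfl⟩ := h
  have hW1 : W * Wᴴ = 1 := Matrix.mem_unitaryGroup_iff.1 hW
  have hW2 : Wᴴ * W = 1 := Matrix.mem_unitaryGroup_iff'.1 hW
  refine ⟨?_, ?_, ?_⟩
  · rw [Matrix.conjTranspose_mul, Matrix.conjTranspose_mul, Matrix.conjTranspose_conjTranspose,
      Matrix.diagonal_conjTranspose, Matrix.mul_assoc]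
    congr 3
    ext i
    simp [apply_ite]
  · set E := Matrix.diagonal (fun i : Fin M => if (i : ℕ) < k then (1 : ℂ) else 0)
    have hE : E * E = E := by
      simp [E, Matrix.diagonal_mul_diagonal]
    calc W * E * Wᴴ * (W * E * Wᴴ) = W * (E * (Wᴴ * W) * E) * Wᴴ := by
          simp only [Matrix.mul_assoc]
      _ = _ := by rw [hW2, Matrix.mul_one, hE]
  · rw [Matrix.rank_mul_eq_left_of_isUnit_det, Matrix.rank_mul_eq_right_of_isUnit_det,
      Matrix.rank_diagonal]
    · rw [Fintype.card_subtype]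
      have : (Finset.univ.filter fun i : Fin M => (if (i : ℕ) < k then (1 : ℂ) else 0) ≠ 0) =
          Finset.univ.filter fun i : Fin M => (i : ℕ) < k := by
        ext i; simp
      rw [this, Fin.card_filter_val_lt, min_eq_right hk]
    · exact (Matrix.isUnit_iff_isUnit_det _).1 (IsUnit.of_mul_eq_one _ hW1)
    · exact (Matrix.isUnit_iff_isUnit_det _).1 (IsUnit.of_mul_eq_one _ hW2)

/-- If the Gram matrix has rank `k`, its leading projector acts as the identity on its range and
factors through it. -/
theorem IsLeadingProjector.of_rank_eq {M k : ℕ} {X P : Matrix (Fin M) (Fin M) ℂ}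
    (h : IsLeadingProjector k X P) (hr : (X * Xᴴ).rank = k) :
    P * (X * Xᴴ) = X * Xᴴ ∧ ∃ Y, P = X * Xᴴ * Y := by
  obtain ⟨W, hW, d, hd, hX, rfl⟩ := h
  have hW1 : W * Wᴴ = 1 := Matrix.mem_unitaryGroup_iff.1 hW
  have hW2 : Wᴴ * W = 1 := Matrix.mem_unitaryGroup_iff'.1 hW
  set D := Matrix.diagonal (fun i => (d i : ℂ)) with hD
  have hD' : Wᴴ * (X * Xᴴ) * W = D := by
    calc Wᴴ * (X * Xᴴ) * W = (Wᴴ * W) * D * (Wᴴ * W) := by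
          rw [hX]; simp only [Matrix.mul_assoc]
      _ = D := by rw [hW2, Matrix.mul_one, Matrix.one_mul]
  have hnn : ∀ i, 0 ≤ d i := by
    have hps : D.PosSemidef := by
      rw [← hD']
      exact (Matrix.posSemidef_self_mul_conjTranspose X).conjTranspose_mul_mul_same W
    intro i
    have := Matrix.posSemidef_diagonal_iff.1 hps i
    exact_mod_cast this
  have hcard : (Finset.univ.filter fun i => 0 < d i).card = k := by
    rw [hX, Matrix.rank_mul_eq_left_of_isUnit_det, Matrix.rank_mul_eq_right_of_isUnit_det, hD,
      Matrix.rank_diagonal, Fintype.card_subtype] at hr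
    · rw [← hr]
      congr 1
      ext i
      simp [(hnn i).lt_iff_ne']
    · exact (Matrix.isUnit_iff_isUnit_det _).1 (IsUnit.of_mul_eq_one _ hW1)
    · exact (Matrix.isUnit_iff_isUnit_det _).1 (IsUnit.of_mul_eq_one _ hW2)
  -- Exactly `k` eigenvalues are positive and they come in decreasing order, so they are the first
  -- `k`.
  have hpos : ∀ i : Fin M, (i : ℕ) < k ↔ 0 < d i := fun i => by
    rw [← hcard]
    exact Tuple.lt_card_gt_iff_apply_gt_of_antitone hd
  set E := Matrix.diagonal (fun i : Fin M => if (i : ℕ) < k then (1 : ℂ) else 0) with hE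
  have hED : E * D = D := by
    rw [hE, hD, Matrix.diagonal_mul_diagonal]
    congr 1
    ext i
    rcases (hnn i).eq_or_lt with h0 | h0
    · simp [← h0]
    · simp [(hpos i).2 h0]
  -- As `0⁻¹ = 0`, the entrywise inverse is the pseudoinverse of `D`.
  have hDE : D * Matrix.diagonal (fun i => (d i : ℂ)⁻¹) = E := by
    rw [hE, hD, Matrix.diagonal_mul_diagonal]
    congr 1
    ext i
    rcases (hnn i).eq_or_lt with h0 | h0
    · have : ¬ (i : ℕ) < k := fun h => ((hpos i).1 h).ne h0
      simp [← h0, this]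
    · have : (d i : ℂ) ≠ 0 := by exact_mod_cast h0.ne'
      simp [(hpos i).2 h0, this]
  refine ⟨?_, W * Matrix.diagonal (fun i => (d i : ℂ)⁻¹) * Wᴴ, ?_⟩
  · calc W * E * Wᴴ * (X * Xᴴ) = W * (E * ((Wᴴ * W) * D)) * Wᴴ := by
          rw [hX]; simp only [Matrix.mul_assoc]
      _ = X * Xᴴ := by rw [hW2, Matrix.one_mul, hED, hX]
  · symm
    calc X * Xᴴ * (W * Matrix.diagonal (fun i => (d i : ℂ)⁻¹) * Wᴴ)
        = W * (D * (Wᴴ * W) * Matrix.diagonal (fun i => (d i : ℂ)⁻¹)) * Wᴴ := by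
          rw [hX]; simp only [Matrix.mul_assoc]
      _ = W * E * Wᴴ := by rw [hW2, Matrix.mul_one, hDE]

/-! ### Projectors onto column spaces -/

theorem mem_colSpace_iff {M n : ℕ} {A : Matrix (Fin M) (Fin n) ℂ}
    {x : EuclideanSpace ℂ (Fin M)} : x ∈ colSpace A ↔ ∃ v, A.mulVec v = x.ofLp := by
  constructor
  · rintro ⟨v, rfl⟩
    exact ⟨v.ofLp, rfl⟩
  · rintro ⟨v, hv⟩
    exact ⟨WithLp.toLp 2 v, by ext i; simp [← hv]⟩

/-- A Hermitian matrix that fixes the columns of `A` and whose columns are in the column space of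
`A` is the orthogonal projector onto that space. -/
theorem eq_rangeProjector {M n : ℕ} {A : Matrix (Fin M) (Fin n) ℂ}
    {P : Matrix (Fin M) (Fin M) ℂ} (hP : Pᴴ = P) (hPA : P * A = A) {Y : Matrix (Fin n) (Fin M) ℂ}
    (hY : P = A * Y) : P = rangeProjector A := by
  rw [rangeProjector, LinearEquiv.eq_symm_apply]
  ext1 x
  symm
  refine Submodule.eq_starProjection_of_mem_of_inner_eq_zero ?_ ?_
  · refine mem_colSpace_iff.2 ⟨Y.mulVec x.ofLp, ?_⟩
    rw [Matrix.mulVec_mulVec, ← hY]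
    rfl
  · intro w hw
    obtain ⟨v, hv⟩ := mem_colSpace_iff.1 hw
    have hsub : (x - Matrix.toEuclideanLin P x).ofLp = (1 - P).mulVec x.ofLp := by
      rw [Matrix.sub_mulVec, Matrix.one_mulVec]
      rfl
    have hz : (1 - P) * A = 0 := by rw [Matrix.sub_mul, Matrix.one_mul, hPA, sub_self]
    have hH : (1 - P)ᴴ = 1 - P := by rw [Matrix.conjTranspose_sub, hP, Matrix.conjTranspose_one]
    rw [EuclideanSpace.inner_eq_star_dotProduct, hsub, ← hv, Matrix.star_mulVec, hH, dotProduct_comm,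
      ← Matrix.dotProduct_mulVec, Matrix.mulVec_mulVec, hz, Matrix.zero_mulVec, dotProduct_zero]

/-- The leading projector of `A D Aᴴ`, `A` with independent columns, is `P_A`. -/
theorem IsLeadingProjector.eq_rangeProjector {M k : ℕ} {A : Matrix (Fin M) (Fin k) ℂ}
    (hA : Function.Injective A.mulVec) {c : Fin k → ℝ} (hc : ∀ l, 0 < c l)
    {P : Matrix (Fin M) (Fin M) ℂ} (hkM : k ≤ M)
    (h : IsLeadingProjector k (A * Matrix.diagonal (fun l => (c l : ℂ)) * Aᴴ) P) :
    P = rangeProjector A := by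
  set D := Matrix.diagonal (fun l => (c l : ℂ)) with hD
  set X := A * D * Aᴴ with hX
  have hG : IsUnit (Aᴴ * A) := by
    rw [← Matrix.mulVec_injective_iff_isUnit]
    intro v w hvw
    refine hA (sub_eq_zero.1 ?_)
    rw [← Matrix.mulVec_sub, ← Matrix.conjTranspose_mul_self_mulVec_eq_zero, Matrix.mulVec_sub]
    exact sub_eq_zero.2 hvw
  have hDu : IsUnit D := by
    rw [Matrix.isUnit_iff_isUnit_det, hD, Matrix.det_diagonal, isUnit_iff_ne_zero]
    exact Finset.prod_ne_zero_iff.2 fun l _ => by exact_mod_cast (hc l).ne'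
  have hDh : Dᴴ = D := by
    rw [hD, Matrix.diagonal_conjTranspose]
    congr 1
    ext l
    simp
  have hXX : X * Xᴴ = A * (D * (Aᴴ * A) * D * Aᴴ) := by
    rw [hX, Matrix.conjTranspose_mul, Matrix.conjTranspose_mul, hDh,
      Matrix.conjTranspose_conjTranspose]
    simp only [Matrix.mul_assoc]
  -- `A` factors through the Gram matrix: on the range of `A` the latter acts by the invertible `D
  -- (AᴴA) D (AᴴA)`, with inverse `V`. This yields the lower rank bound and `P A = A`.
  obtain ⟨Z, hZ⟩ : ∃ Z : Matrix (Fin M) (Fin k) ℂ, X * Xᴴ * Z = A := by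
    obtain ⟨V, hV, -⟩ := isUnit_iff_exists.1 (((hDu.mul hG).mul hDu).mul hG)
    refine ⟨A * V, ?_⟩
    calc X * Xᴴ * (A * V) = A * (D * (Aᴴ * A) * D * (Aᴴ * A) * V) := by
          rw [hXX]; simp only [Matrix.mul_assoc]
      _ = A := by rw [hV, Matrix.mul_one]
  have hrA : A.rank = k := by
    rw [← Matrix.rank_conjTranspose_mul_self, Matrix.rank_of_isUnit _ hG, Fintype.card_fin]
  have hr : (X * Xᴴ).rank = k := by
    refine le_antisymm ?_ ?_
    · rw [hXX]
      exact (Matrix.rank_mul_le_left _ _).trans hrA.le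
    · calc k = (X * Xᴴ * Z).rank := by rw [hZ, hrA]
        _ ≤ _ := Matrix.rank_mul_le_left _ _
  obtain ⟨h1, Y, hY⟩ := h.of_rank_eq hr
  refine SubspaceLearning.eq_rangeProjector (h.mem_grassmannian hkM).1 ?_
    (Y := D * (Aᴴ * A) * D * Aᴴ * Y) ?_
  · calc P * A = P * (X * Xᴴ) * Z := by rw [Matrix.mul_assoc, hZ]
      _ = A := by rw [h1, hZ]
  · rw [hY, hXX, Matrix.mul_assoc]

/-! ### The geodesic distance of a point to itself -/

theorem unitaryBasis_conjTranspose_mul_self {M : ℕ}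
    (U : Submodule ℂ (EuclideanSpace ℂ (Fin M))) : (unitaryBasis U)ᴴ * unitaryBasis U = 1 := by
  ext i j
  have h := orthonormal_iff_ite.1 (stdOrthonormalBasis ℂ U).orthonormal i j
  rw [Submodule.coe_inner, EuclideanSpace.inner_eq_star_dotProduct, dotProduct_comm] at h
  rw [Matrix.one_apply, ← h]
  rfl

/-- The squared singular values are eigenvalues of `id* id = id`, whose only eigenvalue is `1`. -/
theorem singularValues_id {E : Type*} [NormedAddCommGroup E] [InnerProductSpace ℂ E]
    [FiniteDimensional ℂ E] {i : ℕ} (hi : i < Module.finrank ℂ E) :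
    (LinearMap.id : E →ₗ[ℂ] E).singularValues i = 1 := by
  have h := (LinearMap.id : E →ₗ[ℂ] E).hasEigenvalue_adjoint_comp_self_sq_singularValues hi
  obtain ⟨v, hv⟩ := h.exists_hasEigenvector
  have hv1 := hv.apply_eq_smul
  have hadj : LinearMap.adjoint (LinearMap.id : E →ₗ[ℂ] E) = LinearMap.id :=
    LinearMap.adjoint_id
  rw [hadj, LinearMap.id_comp, LinearMap.id_apply] at hv1
  have h2 : (1 - (((LinearMap.id : E →ₗ[ℂ] E).singularValues i : ℂ)) ^ 2) • v = 0 := by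
    rw [sub_smul, one_smul, sub_eq_zero]
    exact_mod_cast hv1
  have h3 := (smul_eq_zero.1 h2).resolve_right hv.2
  have h4 : (LinearMap.id : E →ₗ[ℂ] E).singularValues i ^ 2 = 1 := by
    have := (sub_eq_zero.1 h3).symm
    exact_mod_cast this
  exact (pow_eq_one_iff_of_nonneg (LinearMap.singularValues_nonneg _ _) two_ne_zero).1 h4

theorem principalAngle_self {M : ℕ} (U : Submodule ℂ (EuclideanSpace ℂ (Fin M))) {i : ℕ}
    (hi : i < Module.finrank ℂ U) : principalAngle U U i = 0 := by
  have h1 : Matrix.toEuclideanLin (1 : Matrix (Fin (Module.finrank ℂ U)) _ ℂ) = LinearMap.id := by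
    ext1 x
    simp
  rw [principalAngle, unitaryBasis_conjTranspose_mul_self, h1, singularValues_id (by simpa),
    Real.arccos_one]

theorem finrank_colSpace {M n : ℕ} (A : Matrix (Fin M) (Fin n) ℂ) :
    Module.finrank ℂ (colSpace A) = A.rank := by
  rw [colSpace, Matrix.toEuclideanLin_eq_toLin_orthonormal, ← Matrix.rank_eq_finrank_range_toLin]

/-- The rank condition matters: singular values past the dimension are `0` and would contribute
angles `π / 2`. -/
theorem geodesicDist_self {M k : ℕ} {P : Matrix (Fin M) (Fin M) ℂ} (hP : P ∈ Grassmannian k M) :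
    geodesicDist k P P = 0 := by
  rw [geodesicDist, Finset.sum_eq_zero, Real.sqrt_zero]
  intro i hi
  rw [principalAngle_self, zero_pow two_ne_zero]
  rw [finrank_colSpace, hP.2.2]
  exact Finset.mem_range.1 hi

/-! ### The steering matrix and the co-array -/

/-- Exhibits the steering matrix as a Vandermonde matrix with nonzero column scalings. -/
theorem arrayManifold_eq (M : ℕ) (θ : ℝ) (i : Fin M) :
    arrayManifold M θ i = arrayManifold M θ ⟨0, i.pos⟩ *
      Complex.exp (Complex.I * ((Real.pi * Real.cos θ : ℝ) : ℂ)) ^ (i : ℕ) := by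
  rw [arrayManifold, arrayManifold, ← Complex.exp_nat_mul, ← Complex.exp_add]
  congr 1
  push_cast
  ring

/-- The phase `π cos θ` stays in `(-π, π]`, where `exp` is injective. On the closed interval this
fails: `θ = 0` and `θ = π` both give `-1`. -/
theorem exp_pi_mul_cos_injOn :
    Set.InjOn (fun θ : ℝ => Complex.exp (Complex.I * ((Real.pi * Real.cos θ : ℝ) : ℂ)))
      (Set.Ioo 0 Real.pi) := by
  have hcos : ∀ θ ∈ Set.Ioo 0 Real.pi,
      -Real.pi < Real.pi * Real.cos θ ∧ Real.pi * Real.cos θ ≤ Real.pi := by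
    intro θ hθ
    have h1 : -1 < Real.cos θ := by
      rw [← Real.cos_pi]
      exact Real.strictAntiOn_cos ⟨hθ.1.le, hθ.2.le⟩ ⟨Real.pi_pos.le, le_rfl⟩ hθ.2
    constructor <;> nlinarith [Real.cos_le_one θ, Real.pi_pos]
  intro x hx y hy h
  have him : ∀ t : ℝ, (Complex.I * (t : ℂ)).im = t := fun t => by simp
  have h' := Complex.exp_inj_of_neg_pi_lt_of_le_pi (by rw [him]; exact (hcos x hx).1)
    (by rw [him]; exact (hcos x hx).2) (by rw [him]; exact (hcos y hy).1)
    (by rw [him]; exact (hcos y hy).2) h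
  have h2 := congrArg Complex.im h'
  rw [him, him] at h2
  exact Real.injOn_cos ⟨hx.1.le, hx.2.le⟩ ⟨hy.1.le, hy.2.le⟩
    (mul_left_cancel₀ Real.pi_ne_zero h2)

/-- Steering vectors of at most `M` distinct directions in `(0, π)` are linearly independent. -/
theorem steeringMatrix_mulVec_injective {M k : ℕ} (hkM : k ≤ M) {θ : Fin k → ℝ}
    (hθ : ∀ l, θ l ∈ Set.Ioo 0 Real.pi) (hinj : Function.Injective θ) :
    Function.Injective (steeringMatrix M θ).mulVec := by
  suffices h : ∀ v, (steeringMatrix M θ).mulVec v = 0 → v = 0 by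
    intro v w hvw
    refine sub_eq_zero.1 (h _ ?_)
    rw [Matrix.mulVec_sub]
    exact sub_eq_zero.2 hvw
  intro v hv
  rcases Nat.eq_zero_or_pos k with rfl | hk
  · exact Subsingleton.elim _ _
  have hM : 0 < M := hk.trans_le hkM
  have hz : Function.Injective fun l =>
      Complex.exp (Complex.I * ((Real.pi * Real.cos (θ l) : ℝ) : ℂ)) :=
    fun a b hab => hinj (exp_pi_mul_cos_injOn (hθ a) (hθ b) hab)
  -- The first `k` rows suffice; the column scalings are absorbed into the coefficient vector.
  have h0 := Matrix.eq_zero_of_forall_pow_sum_mul_pow_eq_zero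
    (v := fun l => v l * arrayManifold M (θ l) ⟨0, hM⟩) hz fun i => by
      have hi := congrFun hv (Fin.castLE hkM i)
      rw [Matrix.mulVec, dotProduct, Pi.zero_apply] at hi
      rw [← hi]
      refine Finset.sum_congr rfl fun l _ => ?_
      rw [steeringMatrix, Matrix.of_apply, arrayManifold_eq M (θ l) (Fin.castLE hkM i),
        Fin.val_castLE]
      ring
  funext l
  exact (mul_eq_zero.1 (congrFun h0 l)).resolve_right (Complex.exp_ne_zero _)

/-- The ULA covariance is Toeplitz. -/
theorem ulaCovariance_apply {M k : ℕ} (p θ : Fin k → ℝ) (a b : Fin M) :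
    ulaCovariance M p θ a b = ∑ l, (p l : ℂ) *
      Complex.exp (Complex.I * Real.pi * ((a : ℤ) - (b : ℤ) : ℤ) * Real.cos (θ l)) := by
  rw [ulaCovariance, Matrix.mul_apply]
  refine Finset.sum_congr rfl fun l _ => ?_
  rw [Matrix.mul_diagonal, Matrix.conjTranspose_apply, steeringMatrix, Matrix.of_apply,
    Matrix.of_apply, arrayManifold, arrayManifold, Complex.star_def, ← Complex.exp_conj,
    mul_right_comm, ← Complex.exp_add, mul_comm]
  congr 2
  rw [map_mul, Complex.conj_I, Complex.conj_ofReal]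
  push_cast
  ring

theorem slaCovariance_eq_submatrix {M N k : ℕ} (s : Fin N → Fin M) (p θ : Fin k → ℝ) :
    slaCovariance s p θ = (ulaCovariance M p θ).submatrix s s := by
  ext i j
  simp [slaCovariance, selectionMatrix, Matrix.mul_apply]

/-- Every entry of the ULA covariance is read off at a fixed position of the covariance of a
hole-free sparse array. -/
theorem HoleFree.exists_lag {M N : ℕ} {s : Fin N → Fin M} (hs : HoleFree s) (q : Fin M × Fin M) :
    ∃ r : Fin N × Fin N, ((s r.1 : ℕ) : ℤ) - ((s r.2 : ℕ) : ℤ) = ((q.1 : ℕ) : ℤ) - (q.2 : ℕ) := by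
  rcases le_total (q.2 : ℕ) (q.1 : ℕ) with h | h
  · obtain ⟨i, j, hij⟩ := hs (q.1 - q.2) (by omega)
    exact ⟨(i, j), by dsimp only; omega⟩
  · obtain ⟨i, j, hij⟩ := hs (q.2 - q.1) (by omega)
    exact ⟨(j, i), by dsimp only; omega⟩

/-! ### Networks that rearrange their input -/

/-- A ReLU network with one hidden layer that rearranges its input, by `x = max 0 x - max 0 (-x)`. -/
theorem ReLUNetwork.exists_eval_eq_comp {κ ι : Type} [Fintype ι] (φ : κ → ι) :
    ∃ F : ReLUNetwork κ ι, ∀ x, F.eval x = x ∘ φ := by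
  let e := Fintype.equivFin (ι ⊕ ι)
  let L : (ι → ℝ) →ₗ[ℝ] (Fin (Fintype.card (ι ⊕ ι)) → ℝ) :=
    LinearMap.pi fun m => Sum.elim (fun i => (LinearMap.proj i : (ι → ℝ) →ₗ[ℝ] ℝ))
      (fun i => -LinearMap.proj i) (e.symm m)
  let L' : (Fin (Fintype.card (ι ⊕ ι)) → ℝ) →ₗ[ℝ] (κ → ℝ) :=
    LinearMap.pi fun a =>
      (LinearMap.proj (e (Sum.inl (φ a))) : (Fin (Fintype.card (ι ⊕ ι)) → ℝ) →ₗ[ℝ] ℝ) -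
        LinearMap.proj (e (Sum.inr (φ a)))
  refine ⟨.hidden _ L.toAffineMap (.output L'.toAffineMap), fun x => ?_⟩
  funext a
  have h : (ReLUNetwork.hidden _ L.toAffineMap (.output L'.toAffineMap)).eval x a =
      max 0 (x (φ a)) - max 0 (-x (φ a)) := by
    simp [ReLUNetwork.eval, L, L']
  rw [h, Function.comp_apply]
  rcases le_total 0 (x (φ a)) with h0 | h0 <;> simp [h0]

/-- Some ReLU network recovers the ULA covariance from that of a hole-free sparse array. -/
theorem exists_evalMatrix_slaCovariance_eq {M N k : ℕ} {s : Fin N → Fin M} (hs : HoleFree s)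
    (p : Fin k → ℝ) :
    ∃ F : ReLUNetwork (ReImIndex M) (ReImIndex N),
      ∀ θ, F.evalMatrix (slaCovariance s p θ) = ulaCovariance M p θ := by
  choose g hg using hs.exists_lag
  obtain ⟨F, hF⟩ := ReLUNetwork.exists_eval_eq_comp (Sum.map g g)
  refine ⟨F, fun θ => ?_⟩
  have key : ∀ a b, slaCovariance s p θ (g (a, b)).1 (g (a, b)).2 = ulaCovariance M p θ a b := by
    intro a b
    rw [slaCovariance_eq_submatrix, Matrix.submatrix_apply, ulaCovariance_apply,
      ulaCovariance_apply, hg]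
  ext a b
  rw [ReLUNetwork.evalMatrix, hF, ← key]
  rfl

/-! ### Almost every choice of directions -/

/-- The exceptions lie on the faces of the cube and on the hyperplanes `θ i = θ j`, all of which are
null. -/
theorem ae_mem_Ioo_and_injective (k : ℕ) :
    ∀ᵐ θ ∂(volume.restrict (Set.Icc (0 : Fin k → ℝ) (fun _ => Real.pi))),
      (∀ l, θ l ∈ Set.Ioo 0 Real.pi) ∧ Function.Injective θ := by
  have h1 : ∀ᵐ θ ∂(volume.restrict (Set.Icc (0 : Fin k → ℝ) (fun _ => Real.pi))),
      ∀ l, θ l ∈ Set.Ioo 0 Real.pi := by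
    have he : (Set.univ.pi fun l => Set.Ioo ((0 : Fin k → ℝ) l) ((fun _ => Real.pi) l)) =ᵐ[volume]
        Set.Icc (0 : Fin k → ℝ) (fun _ => Real.pi) := Measure.univ_pi_Ioo_ae_eq_Icc
    rw [← Measure.restrict_congr_set he]
    filter_upwards [ae_restrict_mem
      (MeasurableSet.univ_pi fun l => measurableSet_Ioo)] with θ hθ l
    exact hθ l trivial
  have h2 : ∀ᵐ θ : Fin k → ℝ, ∀ i j, i ≠ j → θ i ≠ θ j := by
    rw [ae_all_iff]
    intro i
    rw [ae_all_iff]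
    intro j
    by_cases hij : i = j
    · simp [hij]
    have h0 := Measure.addHaar_submodule (volume : Measure (Fin k → ℝ))
      (LinearMap.ker ((LinearMap.proj i : (Fin k → ℝ) →ₗ[ℝ] ℝ) - LinearMap.proj j)) (by
        intro htop
        have : Pi.single i (1 : ℝ) ∈
            LinearMap.ker ((LinearMap.proj i : (Fin k → ℝ) →ₗ[ℝ] ℝ) - LinearMap.proj j) :=
          htop ▸ Submodule.mem_top
        simp [Ne.symm hij] at this)
    filter_upwards [measure_eq_zero_iff_ae_notMem.1 h0] with θ hθ _ h
    exact hθ (LinearMap.mem_ker.2 (sub_eq_zero.2 h))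
  filter_upwards [h1, ae_restrict_of_ae h2] with θ ha hb
  refine ⟨ha, fun i j h => ?_⟩
  by_contra hne
  exact hb i j hne h

end SubspaceLearning

theorem theorem1 (M N k : ℕ) (hk : 1 ≤ k) (hkM : k ≤ M - 1)
    (s : Fin N → Fin M) (hs : StrictMono s) (hhole : SubspaceLearning.HoleFree s)
    (p : Fin k → ℝ) (hp : ∀ l, 0 < p l) (ε : ℝ) (hε : 0 < ε) :
    ∃ (F : SubspaceLearning.ReLUNetwork
          (SubspaceLearning.ReImIndex M) (SubspaceLearning.ReImIndex N))
      (f : Matrix (Fin N) (Fin N) ℂ → SubspaceLearning.Grassmannian k M),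
      (∀ R, SubspaceLearning.IsLeadingProjector k (F.evalMatrix R)
        (f R : Matrix (Fin M) (Fin M) ℂ)) ∧
      (∀ᵐ θ ∂(volume.restrict (Set.Icc (0 : Fin k → ℝ) (fun _ => Real.pi))),
        ∀ P : Matrix (Fin M) (Fin M) ℂ,
          SubspaceLearning.IsLeadingProjector k
            (F.evalMatrix (SubspaceLearning.slaCovariance s p θ)) P →
          P = (f (SubspaceLearning.slaCovariance s p θ) : Matrix (Fin M) (Fin M) ℂ)) ∧
      IntegrableOn
        (fun θ : Fin k → ℝ => SubspaceLearning.geodesicDist k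
          (f (SubspaceLearning.slaCovariance s p θ) : Matrix (Fin M) (Fin M) ℂ)
          (SubspaceLearning.rangeProjector (SubspaceLearning.steeringMatrix M θ)))
        (Set.Icc (0 : Fin k → ℝ) (fun _ => Real.pi)) volume ∧
      ∫ θ in Set.Icc (0 : Fin k → ℝ) (fun _ => Real.pi),
        SubspaceLearning.geodesicDist k
          (f (SubspaceLearning.slaCovariance s p θ) : Matrix (Fin M) (Fin M) ℂ)
          (SubspaceLearning.rangeProjector (SubspaceLearning.steeringMatrix M θ)) < ε := by
  have hkM' : k ≤ M := hkM.trans (Nat.sub_le _ _)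
  obtain ⟨F, hF⟩ := SubspaceLearning.exists_evalMatrix_slaCovariance_eq hhole p
  -- An arbitrary choice is harmless: by `huniq` it is forced at almost every covariance that
  -- occurs.
  choose P hP using fun R => SubspaceLearning.exists_isLeadingProjector k (F.evalMatrix R)
  have huniq : ∀ᵐ θ ∂(volume.restrict (Set.Icc (0 : Fin k → ℝ) (fun _ => Real.pi))),
      ∀ Q, SubspaceLearning.IsLeadingProjector k
        (F.evalMatrix (SubspaceLearning.slaCovariance s p θ)) Q →
        Q = SubspaceLearning.rangeProjector (SubspaceLearning.steeringMatrix M θ) := by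
    filter_upwards [SubspaceLearning.ae_mem_Ioo_and_injective k] with θ hθ Q hQ
    rw [hF] at hQ
    exact hQ.eq_rangeProjector
      (SubspaceLearning.steeringMatrix_mulVec_injective hkM' hθ.1 hθ.2) hp hkM'
  have hzero : (fun θ : Fin k → ℝ => SubspaceLearning.geodesicDist k
      (P (SubspaceLearning.slaCovariance s p θ))
      (SubspaceLearning.rangeProjector (SubspaceLearning.steeringMatrix M θ)))
      =ᵐ[volume.restrict (Set.Icc (0 : Fin k → ℝ) (fun _ => Real.pi))] 0 := by
    filter_upwards [huniq] with θ hθ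
    rw [← hθ _ (hP _), SubspaceLearning.geodesicDist_self ((hP _).mem_grassmannian hkM')]
    rfl
  refine ⟨F, fun R => ⟨P R, (hP R).mem_grassmannian hkM'⟩, hP, ?_, ?_, ?_⟩
  · filter_upwards [huniq] with θ hθ Q hQ
    rw [hθ Q hQ, hθ _ (hP _)]
  -- Almost everywhere equality with zero also supplies measurability, which the arbitrary choice of
  -- `P` does not.
  · exact (integrable_zero _ _ _).congr hzero.symm
  · rw [integral_congr_ae hzero]
    simpa using hε
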